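/- A resistance network $(G,c)$ consists of a vertex set $V$ and a symmetric conductance function $c:V\times V\to[0,\infty)$ with $c_{xx}=0$ and $c(x):=\sum_y c_{xy}<\infty$ for every $x$, such that any two vertices are joined by a finite chain of positive conductances. Vertices of infinite degree are allowed. Its Laplacian is $(\Delta v)(x)=\sum_y c_{xy}(v(x)-v(y))$. Its random walk has transition probabilities $p(x,y)=c_{xy}/c(x)$, and the network is transient if $\sum_n p^{(n)}(x,x)<\infty$ for every $x$. On a finite connected network the effective resistance between $x$ and $y$ is $v(x)-v(y)$ for any $v$ with $\Delta v=\delta_x-\delta_y$. An exhaustion $\{G_k\}$ is an increasing sequence of finite vertex sets with union $V$, each of which induces a connected full subnetwork. For a finite vertex set $H$, the free network $H^F$ is the full subnetwork on $H$, with conductances $c_{xy}$ for $x,y\in H$. The trace network $H^{tr}$ on $H$ has edge data given by the Schur complement of the Laplacian: write $$\Delta=\begin{pmatrix}A&B^T\\B&D\end{pmatrix}$$ in blocks with respect to $H$ and its complement $H^c$, and let $D^{-1}=\big(\sum_{n\ge0}P_D^n\big)c_D^{-1}$, where $P_D$ is the block of the transition matrix on $H^c\times H^c$ and $c_D$ is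 the diagonal matrix of the $c(x)$, $x\in H^c$. For $x\neq y$ in $H$ the conductance between $x$ and $y$ in $H^{tr}$ is minus the $(x,y)$ entry of $A-B^TD^{-1}B$. Let $R_{H^F}$ and $R_{H^{tr}}$ be the effective resistances of these two finite networks. Theorem. Let $(G,c)$ be a transient network and let $a,b\in V$. Exhaustions of $G$ exist, and the limits $$R^F(a,b)=\lim_{k\to\infty}R_{G_k^F}(a,b),\qquad R^{tr}(a,b)=\lim_{k\to\infty}R_{G_k^{tr}}(a,b)$$ exist in $\mathbb{R}$ for every exhaustion $\{G_k\}$, do not depend on the exhaustion, and satisfy $$R^{tr}(a,b)=R^F(a,b).$$ -/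

import Mathlib

open Filter Topology

noncomputable section

namespace TraceRes

/-- Two points are joined by a finite chain of positive conductances. -/
def IsConnected {ι : Type*} (c : ι → ι → ℝ) : Prop :=
  ∀ x y : ι, Relation.ReflTransGen (fun u v => 0 < c u v) x y

/-- The Laplacian `(Δ v)(x) = ∑_y c_{xy} (v(x) - v(y))`. -/
def laplacian {ι : Type*} (c : ι → ι → ℝ) (v : ι → ℝ) (x : ι) : ℝ :=
  ∑' y, c x y * (v x - v y)

open Classical in
/-- `v` is the voltage of a unit current inserted at `x` and withdrawn at `y`:
`Δ v = δ_x - δ_y`. -/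
def IsUnitPotential {ι : Type*} (c : ι → ι → ℝ) (x y : ι) (v : ι → ℝ) : Prop :=
  ∀ z, laplacian c v z = (if z = x then 1 else 0) - (if z = y then 1 else 0)

/-- On a finite network the voltage drop `v(x) - v(y)` does not depend on the choice of the
solution `v` of `Δ v = δ_x - δ_y`. -/
theorem IsUnitPotential.drop_eq {ι : Type*} [Fintype ι] {c : ι → ι → ℝ}
    (hc : ∀ x y, c x y = c y x) {x y : ι} {v w : ι → ℝ}
    (hv : IsUnitPotential c x y v) (hw : IsUnitPotential c x y w) :
    v x - v y = w x - w y := by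
  classical
  have key : ∀ f g : ι → ℝ, IsUnitPotential c x y g →
      ∑ z, f z * laplacian c g z = f x - f y := by
    intro f g hg
    have : ∀ z, f z * laplacian c g z
        = (if z = x then f z else 0) - (if z = y then f z else 0) := by
      intro z
      rw [hg z]
      split_ifs <;> simp
    simp [this]
  have sym : ∑ z, v z * laplacian c w z = ∑ z, w z * laplacian c v z := by
    have e : ∀ f g : ι → ℝ, ∑ z, f z * laplacian c g z
        = ∑ z, ∑ u, c z u * (f z * g z) - ∑ z, ∑ u, c z u * (f z * g u) := by
      intro f g
      rw [← Finset.sum_sub_distrib]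
      refine Finset.sum_congr rfl fun z _ => ?_
      rw [laplacian, tsum_fintype, Finset.mul_sum, ← Finset.sum_sub_distrib]
      exact Finset.sum_congr rfl fun u _ => by ring
    rw [e, e]
    congr 1
    · simp only [mul_comm]
    · rw [Finset.sum_comm]
      refine Finset.sum_congr rfl fun z _ => Finset.sum_congr rfl fun u _ => ?_
      rw [hc u z]; ring
  rw [← key v w hw, sym, key w v hv]

open Classical in
/-- The effective resistance between `x` and `y` in a finite network with conductances `c`:
the voltage drop between `x` and `y` when a unit current is inserted at `x` and withdrawn at
`y`. -/
def effectiveResistance {ι : Type*} (c : ι → ι → ℝ) (x y : ι) : ℝ :=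
  if h : ∃ v, IsUnitPotential c x y v then h.choose x - h.choose y else 0

/-- The product of two matrices with possibly infinite index sets. -/
def infMul {α β γ : Type*} (M : Matrix α β ℝ) (N : Matrix β γ ℝ) : Matrix α γ ℝ :=
  fun i k => ∑' j, M i j * N j k

open Classical in
/-- The powers of a possibly infinite square matrix. -/
def infPow {α : Type*} (M : Matrix α α ℝ) : ℕ → Matrix α α ℝ
  | 0 => 1
  | n + 1 => infMul M (infPow M n)

/-- A resistance network with vertex set `V`. -/
structure Network (V : Type*) where
  /-- the conductance `c_{xy}` -/
  cond : V → V → ℝ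
  nonneg : ∀ x y, 0 ≤ cond x y
  symm : ∀ x y, cond x y = cond y x
  no_loop : ∀ x, cond x x = 0
  summable : ∀ x, Summable (cond x)
  connected : IsConnected cond

namespace Network

variable {V : Type*} (N : Network V)

/-- The total conductance `c(x) = ∑_y c_{xy}`. -/
def totalCond (x : V) : ℝ := ∑' y, N.cond x y

/-- The transition matrix `p(x,y) = c_{xy} / c(x)`. -/
def trans : Matrix V V ℝ := fun x y => N.cond x y / N.totalCond x

/-- The network is transient: the expected number of returns `∑_n p^{(n)}(x,x)` of the random
walk to each of its states is finite. -/
def IsTransient : Prop := ∀ x, Summable fun n => infPow N.trans n x x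

open Classical in
/-- The matrix of the Laplacian: `c(x)` on the diagonal, `-c_{xy}` off the diagonal. -/
def lapMatrix : Matrix V V ℝ := fun x y => if x = y then N.totalCond x else -N.cond x y

section Trace

variable (H : Set V)

/-- The block `A` of the Laplacian, on `H × H`. -/
def blockA : Matrix H H ℝ := fun x y => N.lapMatrix x y

/-- The block `Bᵀ` of the Laplacian, on `H × Hᶜ`. -/
def blockBT : Matrix H (Hᶜ : Set V) ℝ := fun x y => N.lapMatrix x y

/-- The block `B` of the Laplacian, on `Hᶜ × H`. -/
def blockB : Matrix (Hᶜ : Set V) H ℝ := fun x y => N.lapMatrix x y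

/-- The block `D` of the Laplacian, on `Hᶜ × Hᶜ`. -/
def blockD : Matrix (Hᶜ : Set V) (Hᶜ : Set V) ℝ := fun x y => N.lapMatrix x y

/-- The block `P_D` of the transition matrix, on `Hᶜ × Hᶜ`, so that `D = c (1 - P_D)`. -/
def transD : Matrix (Hᶜ : Set V) (Hᶜ : Set V) ℝ := fun x y => N.trans x y

/-- The inverse `D⁻¹ = (1 - P_D)⁻¹ c⁻¹ = (∑_n P_D ^ n) c⁻¹` of the block `D` (the Green kernel of
the walk killed on `H`). On an infinite complement `D` may have a kernel in the space of all
functions, and this is the inverse that is meant. -/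
def blockDInv : Matrix (Hᶜ : Set V) (Hᶜ : Set V) ℝ :=
  fun s t => (∑' n, infPow (N.transD H) n s t) / N.totalCond t

open Classical in
/-- `D D⁻¹ = 1` as soon as the expected numbers of visits in the definition of `D⁻¹` are finite. -/
theorem blockD_mul_blockDInv (hpos : ∀ x, 0 < N.totalCond x)
    (hG : ∀ s t, Summable fun n => infPow (N.transD H) n s t) :
    infMul (N.blockD H) (N.blockDInv H) = 1 := by
  have hP0 : ∀ s u, 0 ≤ N.transD H s u := fun s u =>
    div_nonneg (N.nonneg _ _) (hpos _).le
  have hPs : ∀ s, Summable fun u => N.transD H s u := fun s =>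
    ((N.summable s).div_const _).comp_injective Subtype.val_injective
  have hP1 : ∀ s, ∑' u, N.transD H s u ≤ 1 := by
    intro s
    have h1 : ∑' y, N.trans s y = 1 := by
      simp only [trans]
      rw [tsum_div_const]
      exact div_self (hpos s).ne'
    rw [← h1]
    exact ((N.summable s).div_const _).tsum_subtype_le _ _
      (fun y => div_nonneg (N.nonneg _ _) (hpos _).le)
  have hb : ∀ n s t, 0 ≤ infPow (N.transD H) n s t ∧ infPow (N.transD H) n s t ≤ 1 := by
    intro n
    induction n with
    | zero =>
      intro s t
      simp only [infPow, Matrix.one_apply]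
      split_ifs <;> norm_num
    | succ n ih =>
      intro s t
      refine ⟨tsum_nonneg fun u => mul_nonneg (hP0 s u) (ih u t).1, ?_⟩
      refine le_trans (Summable.tsum_le_tsum (fun u => ?_) ?_ (hPs s)) (hP1 s)
      · exact mul_le_of_le_one_right (hP0 s u) (ih u t).2
      · exact Summable.of_nonneg_of_le (fun u => mul_nonneg (hP0 s u) (ih u t).1)
          (fun u => mul_le_of_le_one_right (hP0 s u) (ih u t).2) (hPs s)
  have hrow : ∀ n s t, Summable fun u => N.transD H s u * infPow (N.transD H) n u t :=
    fun n s t => Summable.of_nonneg_of_le (fun u => mul_nonneg (hP0 s u) (hb n u t).1)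
      (fun u => mul_le_of_le_one_right (hP0 s u) (hb n u t).2) (hPs s)
  ext s t
  have hprod : Summable fun q : ℕ × (Hᶜ : Set V) =>
      N.transD H s q.2 * infPow (N.transD H) q.1 q.2 t := by
    rw [summable_prod_of_nonneg fun q => mul_nonneg (hP0 s q.2) (hb q.1 q.2 t).1]
    exact ⟨fun n => hrow n s t, (summable_nat_add_iff 1).2 (hG s t)⟩
  have hswap : ∑' u, N.transD H s u * ∑' n, infPow (N.transD H) n u t
      = ∑' n, infPow (N.transD H) (n + 1) s t := by
    simp only [← tsum_mul_left]
    exact (Summable.tsum_comm (f := fun u n => N.transD H s u * infPow (N.transD H) n u t)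
      hprod.prod_symm).symm
  have hsum : Summable fun u => N.transD H s u * ∑' n, infPow (N.transD H) n u t := by
    simp only [← tsum_mul_left]
    exact hprod.prod_symm.prod
  have hD : ∀ u, N.blockD H s u * N.blockDInv H u t
      = (if u = s then N.totalCond s * N.blockDInv H s t else 0)
        - N.totalCond s / N.totalCond t *
          (N.transD H s u * ∑' n, infPow (N.transD H) n u t) := by
    intro u
    have hs := (hpos s).ne'
    by_cases h : u = s
    · subst h
      simp [blockD, blockDInv, lapMatrix, transD, trans, N.no_loop]
    · have h' : (s : V) ≠ u := fun e => h (Subtype.ext e.symm)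
      simp only [blockD, blockDInv, lapMatrix, transD, trans, h', h, if_false]
      field_simp
      ring
  have h0 := (hG s t).tsum_eq_zero_add
  rw [infMul]
  simp only [hD]
  rw [Summable.tsum_sub (summable_of_hasFiniteSupport ((Set.finite_singleton s).subset (by
    intro u hu; by_contra h; simp at h; simp [h] at hu))) (hsum.mul_left _), tsum_ite_eq,
    tsum_mul_left, hswap, blockDInv, h0]
  have ht := (hpos t).ne'
  simp only [infPow, Matrix.one_apply]
  by_cases h : s = t
  · subst h
    simp only [if_true]
    field_simp
    ring
  · simp only [h, if_false]
    ring

/-- The Schur complement `tr(Δ, H) = A - Bᵀ D⁻¹ B`. -/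
def schur : Matrix H H ℝ :=
  N.blockA H - infMul (N.blockBT H) (infMul (N.blockDInv H) (N.blockB H))

open Classical in
/-- The conductances of the trace network on `H`, whose edge data are read off from the Schur
complement as from a Laplacian: `c_{xy}` is minus the entry at `(x,y)` for `x ≠ y`. -/
def traceCond (x y : H) : ℝ := if x = y then 0 else -N.schur H x y

/-- The conductances of the free (that is, full) subnetwork on `H`. -/
def freeCond (x y : H) : ℝ := N.cond x y

end Trace

open Classical in
/-- The effective resistance between `a` and `b` in the free subnetwork on `H`
(with value `0` if `a` or `b` is not in `H`). -/
def freeResistanceOn (H : Finset V) (a b : V) : ℝ :=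
  if h : a ∈ (H : Set V) ∧ b ∈ (H : Set V) then
    effectiveResistance (N.freeCond (H : Set V)) ⟨a, h.1⟩ ⟨b, h.2⟩ else 0

open Classical in
/-- The effective resistance between `a` and `b` in the trace network on `H`
(with value `0` if `a` or `b` is not in `H`). -/
def traceResistanceOn (H : Finset V) (a b : V) : ℝ :=
  if h : a ∈ (H : Set V) ∧ b ∈ (H : Set V) then
    effectiveResistance (N.traceCond (H : Set V)) ⟨a, h.1⟩ ⟨b, h.2⟩ else 0

/-- An exhaustion: an increasing sequence of finite vertex sets which cover the network and whose
full subnetworks are connected. -/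
structure IsExhaustion (G : ℕ → Finset V) : Prop where
  mono : Monotone G
  cover : ∀ x, ∃ k, x ∈ G k
  connected : ∀ k, IsConnected (N.freeCond (G k : Set V))

/-- `r` is the free resistance `R^F(a,b)`: the limit of the effective resistances in the free
subnetworks along any exhaustion. -/
def IsFreeResistance (a b : V) (r : ℝ) : Prop :=
  (∃ G, N.IsExhaustion G) ∧
    ∀ G, N.IsExhaustion G → Tendsto (fun k => N.freeResistanceOn (G k) a b) atTop (𝓝 r)

/-- `r` is the trace resistance `R^tr(a,b)`: the limit of the effective resistances in the trace
networks along any exhaustion. -/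
def IsTraceResistance (a b : V) (r : ℝ) : Prop :=
  (∃ G, N.IsExhaustion G) ∧
    ∀ G, N.IsExhaustion G → Tendsto (fun k => N.traceResistanceOn (G k) a b) atTop (𝓝 r)

end Network

end TraceRes

end

/-! Both limits are squeezed onto `freeResistanceInf`, the infimum of the free resistances over
finite connected sets containing `a` and `b`.

Fix a finite connected `H`. By `traceCond_eq_toReal`, the trace conductance between `x` and `y` is
the direct conductance plus the contribution of excursions through the complement, weighted by the
probability of returning to `H` at `y`. It dominates the free conductance, so Rayleigh monotonicity
gives one inequality, `traceResistanceOn_le_freeResistanceOn`.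

For the other, let `K` contain `H`. Tracing the finite network on `K` down to `H` preserves
resistances (`isUnitPotential_trace`), and its conductances are sums of `c_{xz} Q_y(z)`, with `Q_y`
the harmonic measure of `y` inside `K`. As `K` grows along an exhaustion, the pointwise liminf of
the `Q_y` is superharmonic off `H` by Fatou, hence at least the hitting probability, which is
minimal. Thus the trace conductances are at most the liminf of those of the traced finite networks
(`etraceCond_le_liminf`). For every `r > 1` the free resistance on a late set is then at most `r`
times the trace resistance on `H` (`eventually_freeResistanceOn_le`), so the infimum bounds the
trace resistance from below. -/

namespace TraceRes

/-! ### Finite networks: energy, Dirichlet problem, Rayleigh monotonicity, traces. -/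

section Finite

variable {ι κ : Type*} [Fintype ι] [Fintype κ]

theorem laplacian_eq_sum (c : ι → ι → ℝ) (v : ι → ℝ) (x : ι) :
    laplacian c v x = ∑ y, c x y * (v x - v y) :=
  tsum_fintype _

/-- The energy form of a finite network. -/
noncomputable def energyForm (c : ι → ι → ℝ) (f g : ι → ℝ) : ℝ :=
  (∑ x, ∑ y, c x y * ((f x - f y) * (g x - g y))) / 2

/-- Summation by parts: average the double sum with its copy under exchange of the two vertices. -/
theorem sum_mul_laplacian {c : ι → ι → ℝ} (hs : ∀ x y, c x y = c y x) (f g : ι → ℝ) :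
    ∑ x, f x * laplacian c g x = energyForm c f g := by
  have h1 : ∑ x, f x * laplacian c g x = ∑ x, ∑ y, c x y * (f x * (g x - g y)) := by
    simp only [laplacian_eq_sum, Finset.mul_sum]
    exact Finset.sum_congr rfl fun x _ => Finset.sum_congr rfl fun y _ => by ring
  have h2 : ∑ x, f x * laplacian c g x = ∑ x, ∑ y, c x y * (f y * (g y - g x)) := by
    rw [h1, Finset.sum_comm]
    exact Finset.sum_congr rfl fun x _ => Finset.sum_congr rfl fun y _ => by rw [hs]
  rw [energyForm, eq_div_iff two_ne_zero, mul_two]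
  nth_rewrite 1 [h1]
  rw [h2]
  simp only [← Finset.sum_add_distrib]
  exact Finset.sum_congr rfl fun x _ => Finset.sum_congr rfl fun y _ => by ring

theorem energyForm_self_nonneg {c : ι → ι → ℝ} (h0 : ∀ x y, 0 ≤ c x y) (f : ι → ℝ) :
    0 ≤ energyForm c f f :=
  div_nonneg (Finset.sum_nonneg fun x _ => Finset.sum_nonneg fun y _ =>
    mul_nonneg (h0 x y) (mul_self_nonneg _)) two_pos.le

theorem eq_of_energyForm_nonpos {c : ι → ι → ℝ} (h0 : ∀ x y, 0 ≤ c x y) (hc : IsConnected c)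
    {f : ι → ℝ} (hf : energyForm c f f ≤ 0) (x y : ι) : f x = f y := by
  have hn : ∀ u v, 0 ≤ c u v * ((f u - f v) * (f u - f v)) := fun u v =>
    mul_nonneg (h0 u v) (mul_self_nonneg _)
  have hz : ∑ u, ∑ v, c u v * ((f u - f v) * (f u - f v)) = 0 := by
    refine le_antisymm ?_ (Finset.sum_nonneg fun u _ => Finset.sum_nonneg fun v _ => hn u v)
    unfold energyForm at hf
    linarith
  have hedge : ∀ u v, 0 < c u v → f u = f v := by
    intro u v huv
    rw [Finset.sum_eq_zero_iff_of_nonneg fun u _ => Finset.sum_nonneg fun v _ => hn u v] at hz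
    have h2 := hz u (Finset.mem_univ _)
    rw [Finset.sum_eq_zero_iff_of_nonneg fun v _ => hn u v] at h2
    have h3 := h2 v (Finset.mem_univ _)
    have h4 := (mul_eq_zero.1 h3).resolve_left huv.ne'
    linarith [mul_self_eq_zero.1 h4]
  induction hc x y with
  | refl => rfl
  | tail _ h ih => exact ih.trans (hedge _ _ h)

/-- The minimum principle. -/
theorem nonneg_of_superharmonic {c : ι → ι → ℝ} (h0 : ∀ x y, 0 ≤ c x y)
    (hs : ∀ x y, c x y = c y x) (hc : IsConnected c) {S : Set ι} (hS : S.Nonempty)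
    {f : ι → ℝ} (hf : ∀ x ∈ S, 0 ≤ f x) (hL : ∀ x ∉ S, 0 ≤ laplacian c f x) (x : ι) :
    0 ≤ f x := by
  -- The negative part of `f` serves as test function: superharmonicity makes its energy pairing
  -- with `f` nonnegative, while pointwise that pairing is at most minus the energy of `g`.
  set g : ι → ℝ := fun x => max (-f x) 0 with hg
  have hgS : ∀ x ∈ S, g x = 0 := fun x hx => max_eq_right (by linarith [hf x hx])
  have h1 : 0 ≤ energyForm c g f := by
    rw [← sum_mul_laplacian hs]
    refine Finset.sum_nonneg fun x _ => ?_
    by_cases hx : x ∈ S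
    · simp [hgS x hx]
    · exact mul_nonneg (le_max_right _ _) (hL x hx)
  have h2 : energyForm c g f ≤ -energyForm c g g := by
    rw [energyForm, energyForm, ← neg_div, ← Finset.sum_neg_distrib]
    refine div_le_div_of_nonneg_right (Finset.sum_le_sum fun x _ => ?_) two_pos.le
    rw [← Finset.sum_neg_distrib]
    refine Finset.sum_le_sum fun y _ => ?_
    rw [← mul_neg]
    refine mul_le_mul_of_nonneg_left ?_ (h0 x y)
    simp only [hg]
    rcases le_total (-f x) 0 with hx | hx <;> rcases le_total (-f y) 0 with hy | hy <;>
      simp only [max_eq_left, max_eq_right, hx, hy] <;> nlinarith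
  obtain ⟨s, hs'⟩ := hS
  have h3 := eq_of_energyForm_nonpos h0 hc (by linarith : energyForm c g g ≤ 0) x s
  rw [hgS s hs'] at h3
  have h4 : -f x ≤ g x := le_max_left _ _
  linarith

theorem laplacian_sub (c : ι → ι → ℝ) (f g : ι → ℝ) (x : ι) :
    laplacian c (f - g) x = laplacian c f x - laplacian c g x := by
  simp only [laplacian_eq_sum, ← Finset.sum_sub_distrib, Pi.sub_apply]
  exact Finset.sum_congr rfl fun y _ => by ring

theorem dirichlet_unique {c : ι → ι → ℝ} (h0 : ∀ x y, 0 ≤ c x y)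
    (hs : ∀ x y, c x y = c y x) (hc : IsConnected c) {S : Set ι} (hS : S.Nonempty)
    {f g : ι → ℝ} (hf : ∀ x ∈ S, f x = g x)
    (hL : ∀ x ∉ S, laplacian c f x = laplacian c g x) : f = g := by
  ext x
  have h1 := nonneg_of_superharmonic h0 hs hc hS (f := f - g)
    (fun x hx => by simp [hf x hx]) (fun x hx => by simp [laplacian_sub, hL x hx]) x
  have h2 := nonneg_of_superharmonic h0 hs hc hS (f := g - f)
    (fun x hx => by simp [hf x hx]) (fun x hx => by simp [laplacian_sub, hL x hx]) x
  simp only [Pi.sub_apply] at h1 h2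
  linarith

/-- Uniqueness is injectivity of a linear endomorphism of a finite-dimensional space, hence gives
surjectivity. -/
theorem dirichlet_exists {c : ι → ι → ℝ} (h0 : ∀ x y, 0 ≤ c x y)
    (hs : ∀ x y, c x y = c y x) (hc : IsConnected c) {S : Set ι} (hS : S.Nonempty)
    (g h : ι → ℝ) :
    ∃ f : ι → ℝ, (∀ x ∈ S, f x = g x) ∧ ∀ x ∉ S, laplacian c f x = h x := by
  classical
  let T : (ι → ℝ) →ₗ[ℝ] (ι → ℝ) :=
    { toFun := fun f x => if x ∈ S then f x else laplacian c f x
      map_add' := by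
        intro f f'
        ext x
        simp only [laplacian_eq_sum, Pi.add_apply]
        split_ifs
        · rfl
        · rw [← Finset.sum_add_distrib]
          exact Finset.sum_congr rfl fun y _ => by ring
      map_smul' := by
        intro r f
        ext x
        simp only [laplacian_eq_sum, Pi.smul_apply, smul_eq_mul, RingHom.id_apply]
        split_ifs
        · rfl
        · rw [Finset.mul_sum]
          exact Finset.sum_congr rfl fun y _ => by ring }
  have hT : ∀ f x, T f x = if x ∈ S then f x else laplacian c f x := fun _ _ => rfl
  have hinj : Function.Injective T := by
    intro f f' hff
    refine dirichlet_unique h0 hs hc hS (fun x hx => ?_) (fun x hx => ?_)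
    · simpa [hT, hx] using congrFun hff x
    · simpa [hT, hx] using congrFun hff x
  obtain ⟨f, hf⟩ := LinearMap.injective_iff_surjective.1 hinj (fun x => if x ∈ S then g x else h x)
  refine ⟨f, fun x hx => ?_, fun x hx => ?_⟩
  · simpa [hT, hx] using congrFun hf x
  · simpa [hT, hx] using congrFun hf x

theorem sum_laplacian {c : ι → ι → ℝ} (hs : ∀ x y, c x y = c y x) (f : ι → ℝ) :
    ∑ x, laplacian c f x = 0 := by
  simpa [energyForm] using sum_mul_laplacian hs (fun _ => 1) f

theorem exists_isUnitPotential {c : ι → ι → ℝ} (h0 : ∀ x y, 0 ≤ c x y)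
    (hs : ∀ x y, c x y = c y x) (hc : IsConnected c) (a b : ι) :
    ∃ v, IsUnitPotential c a b v := by
  classical
  obtain ⟨v, -, hv⟩ := dirichlet_exists h0 hs hc (Set.singleton_nonempty b) 0
    (fun z => (if z = a then 1 else 0) - (if z = b then 1 else 0))
  refine ⟨v, fun z => ?_⟩
  -- The equation at the grounded vertex `b` is forced, since both sides sum to zero over all
  -- vertices.
  by_cases hz : z = b
  · subst hz
    have h1 := sum_laplacian hs v
    have h2 : ∑ x, ((if x = a then (1 : ℝ) else 0) - (if x = z then 1 else 0)) = 0 := by simp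
    rw [← Finset.add_sum_erase _ _ (Finset.mem_univ z)] at h1 h2
    have h3 : ∑ x ∈ Finset.univ.erase z, laplacian c v x
        = ∑ x ∈ Finset.univ.erase z, ((if x = a then (1 : ℝ) else 0) - (if x = z then 1 else 0)) :=
      Finset.sum_congr rfl fun x hx => by rw [hv x (by simpa using hx)]
    have h4 : laplacian c v z
        = (if z = a then (1 : ℝ) else 0) - (if z = z then 1 else 0) := by linarith
    convert h4
  · rw [hv z hz]

theorem IsUnitPotential.effectiveResistance_eq {c : ι → ι → ℝ} (hs : ∀ x y, c x y = c y x)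
    {a b : ι} {v : ι → ℝ} (hv : IsUnitPotential c a b v) :
    effectiveResistance c a b = v a - v b := by
  have h : ∃ v, IsUnitPotential c a b v := ⟨v, hv⟩
  rw [effectiveResistance, dif_pos h]
  exact h.choose_spec.drop_eq hs hv

theorem IsUnitPotential.energyForm_eq {c : ι → ι → ℝ} (hs : ∀ x y, c x y = c y x)
    {a b : ι} {v : ι → ℝ} (hv : IsUnitPotential c a b v) (f : ι → ℝ) :
    energyForm c f v = f a - f b := by
  classical
  rw [← sum_mul_laplacian hs]
  have h : ∀ z, f z * laplacian c v z
      = (if z = a then f z else 0) - (if z = b then f z else 0) := by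
    intro z
    rw [hv z]
    split_ifs <;> simp
  simp [h]

/-- The Dirichlet principle. -/
theorem sq_sub_le_effectiveResistance_mul {c : ι → ι → ℝ} (h0 : ∀ x y, 0 ≤ c x y)
    (hs : ∀ x y, c x y = c y x) (hc : IsConnected c) (a b : ι) (f : ι → ℝ) :
    (f a - f b) ^ 2 ≤ effectiveResistance c a b * energyForm c f f := by
  obtain ⟨v, hv⟩ := exists_isUnitPotential h0 hs hc a b
  have hfv := hv.energyForm_eq hs f
  have hvv := hv.energyForm_eq hs v
  rw [← hv.effectiveResistance_eq hs] at hvv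
  have hexp : ∀ t : ℝ, energyForm c (t • v - f) (t • v - f)
      = energyForm c v v * (t * t) + (-2 * energyForm c f v) * t + energyForm c f f := by
    intro t
    simp only [energyForm, div_mul_eq_mul_div, mul_div_assoc', ← add_div, Finset.mul_sum,
      Finset.sum_mul, ← Finset.sum_add_distrib, Pi.sub_apply, Pi.smul_apply, smul_eq_mul]
    congr 1
    exact Finset.sum_congr rfl fun x _ => Finset.sum_congr rfl fun y _ => by ring
  -- Cauchy–Schwarz for the energy form, where pairing with `v` evaluates `f a - f b`.
  have hd := discrim_le_zero fun t => (energyForm_self_nonneg h0 (t • v - f)).trans_eq (hexp t)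
  rw [discrim, hfv, hvv] at hd
  linarith

theorem effectiveResistance_nonneg {c : ι → ι → ℝ} (h0 : ∀ x y, 0 ≤ c x y)
    (hs : ∀ x y, c x y = c y x) (hc : IsConnected c) (a b : ι) :
    0 ≤ effectiveResistance c a b := by
  obtain ⟨v, hv⟩ := exists_isUnitPotential h0 hs hc a b
  rw [hv.effectiveResistance_eq hs, ← hv.energyForm_eq hs]
  exact energyForm_self_nonneg h0 v

theorem energyForm_comp_le {c : ι → ι → ℝ} {c' : κ → κ → ℝ} (h0 : ∀ x y, 0 ≤ c' x y)
    {e : ι → κ} (he : Function.Injective e) {r : ℝ} (hr : 0 ≤ r)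
    (hle : ∀ x y, c x y ≤ r * c' (e x) (e y)) (f : κ → ℝ) :
    energyForm c (f ∘ e) (f ∘ e) ≤ r * energyForm c' f f := by
  rw [energyForm, energyForm, ← mul_div_assoc]
  refine div_le_div_of_nonneg_right ?_ two_pos.le
  have hn : ∀ p q, 0 ≤ c' p q * ((f p - f q) * (f p - f q)) := fun p q =>
    mul_nonneg (h0 p q) (mul_self_nonneg _)
  have hsum : ∀ g : κ → ℝ, (∀ p, 0 ≤ g p) → ∑ x, g (e x) ≤ ∑ p, g p := fun g hg =>
    (Finset.sum_map Finset.univ ⟨e, he⟩ g).symm.trans_le (Finset.sum_le_univ_sum_of_nonneg hg)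
  calc ∑ x, ∑ y, c x y * (((f ∘ e) x - (f ∘ e) y) * ((f ∘ e) x - (f ∘ e) y))
      ≤ ∑ x, ∑ y, r * (c' (e x) (e y) * ((f (e x) - f (e y)) * (f (e x) - f (e y)))) := by
        refine Finset.sum_le_sum fun x _ => Finset.sum_le_sum fun y _ => ?_
        rw [← mul_assoc r]
        exact mul_le_mul_of_nonneg_right (hle x y) (mul_self_nonneg _)
    _ = r * ∑ x, ∑ y, c' (e x) (e y) * ((f (e x) - f (e y)) * (f (e x) - f (e y))) := by
        simp only [Finset.mul_sum]
    _ ≤ r * ∑ p, ∑ q, c' p q * ((f p - f q) * (f p - f q)) := by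
        refine mul_le_mul_of_nonneg_left ?_ hr
        refine (Finset.sum_le_sum fun x _ => hsum _ (hn (e x))).trans ?_
        exact hsum (fun p => ∑ q, c' p q * ((f p - f q) * (f p - f q)))
          fun p => Finset.sum_nonneg fun q _ => hn p q

/-- Rayleigh monotonicity. -/
theorem effectiveResistance_le_mul {c : ι → ι → ℝ} {c' : κ → κ → ℝ} (h0 : ∀ x y, 0 ≤ c x y)
    (hs : ∀ x y, c x y = c y x) (hc : IsConnected c) (h0' : ∀ x y, 0 ≤ c' x y)
    (hs' : ∀ x y, c' x y = c' y x)
    {e : ι → κ} (he : Function.Injective e) {r : ℝ} (hr : 0 ≤ r)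
    (hle : ∀ x y, c x y ≤ r * c' (e x) (e y)) {a b : ι} {u : κ → ℝ}
    (hu : IsUnitPotential c' (e a) (e b) u) :
    effectiveResistance c' (e a) (e b) ≤ r * effectiveResistance c a b := by
  have h1 := sq_sub_le_effectiveResistance_mul h0 hs hc a b (u ∘ e)
  have h2 := energyForm_comp_le h0' he hr hle u
  have h3 := effectiveResistance_nonneg h0 hs hc a b
  rw [hu.energyForm_eq hs', ← hu.effectiveResistance_eq hs'] at h2
  simp only [Function.comp_apply] at h1
  rw [← hu.effectiveResistance_eq hs'] at h1
  -- The final step cancels one factor of the resistance of `c'`; the negated goal makes that factor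
  -- positive.
  by_contra! h
  have h4 : 0 ≤ r * effectiveResistance c a b := mul_nonneg hr h3
  have h5 := h1.trans (mul_le_mul_of_nonneg_left h2 h3)
  nlinarith

/-- The harmonic measure of the image of `e`. -/
theorem exists_harmonicMeasure {c : κ → κ → ℝ} (h0 : ∀ x y, 0 ≤ c x y)
    (hs : ∀ x y, c x y = c y x) (hc : IsConnected c) [Nonempty ι] {e : ι → κ}
    (he : Function.Injective e) :
    ∃ Q : ι → κ → ℝ, (∀ y z, 0 ≤ Q y z) ∧ (∀ y, Q y (e y) = 1) ∧
      (∀ x y, x ≠ y → Q y (e x) = 0) ∧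
      (∀ y, ∀ z ∉ Set.range e, laplacian c (Q y) z = 0) ∧
      ∀ u : κ → ℝ, (∀ z ∉ Set.range e, laplacian c u z = 0) →
        ∀ z, u z = ∑ y, Q y z * u (e y) := by
  classical
  have hne : (Set.range e).Nonempty := Set.range_nonempty e
  choose Q hQ hQL using fun y : ι => dirichlet_exists h0 hs hc hne
    (fun z => if z = e y then 1 else 0) 0
  have hQ' : ∀ x y, Q y (e x) = if x = y then 1 else 0 := fun x y => by
    rw [hQ y _ ⟨x, rfl⟩]
    simp [he.eq_iff]
  refine ⟨Q, fun y => ?_, fun y => by simp [hQ'], fun x y h => by simp [hQ', h], hQL, ?_⟩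
  · refine nonneg_of_superharmonic h0 hs hc hne (fun z hz => ?_) fun z hz => (hQL y z hz).ge
    rw [hQ y z hz]
    split_ifs <;> norm_num
  · intro u hu z
    refine congrFun (dirichlet_unique h0 hs hc hne (g := fun z => ∑ y, Q y z * u (e y)) ?_ ?_) z
    · rintro _ ⟨x, rfl⟩
      simp [hQ']
    · intro z hz
      have hlin : laplacian c (fun z => ∑ y, Q y z * u (e y)) z
          = ∑ y, laplacian c (Q y) z * u (e y) := by
        simp only [laplacian_eq_sum, Finset.sum_mul]
        rw [Finset.sum_comm]
        refine Finset.sum_congr rfl fun w _ => ?_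
        rw [← Finset.sum_sub_distrib, Finset.mul_sum]
        exact Finset.sum_congr rfl fun y _ => by ring
      rw [hu z hz, hlin]
      exact (Finset.sum_eq_zero fun y _ => by simp [hQL y z hz]).symm

/-- Tracing a finite network on a set of vertices preserves the unit potentials. -/
theorem isUnitPotential_trace {c : κ → κ → ℝ} (h0 : ∀ x y, 0 ≤ c x y)
    (hs : ∀ x y, c x y = c y x) (hc : IsConnected c) [Nonempty ι] {e : ι → κ}
    (he : Function.Injective e) :
    ∃ Q : ι → κ → ℝ, (∀ y z, 0 ≤ Q y z) ∧ (∀ y, Q y (e y) = 1) ∧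
      (∀ x y, x ≠ y → Q y (e x) = 0) ∧
      (∀ y, ∀ z ∉ Set.range e, laplacian c (Q y) z = 0) ∧
      (∀ x y, ∑ z, c (e x) z * Q y z = ∑ z, c (e y) z * Q x z) ∧
      ∀ (a b : ι) (u : κ → ℝ), IsUnitPotential c (e a) (e b) u →
        IsUnitPotential (fun x y => ∑ z, c (e x) z * Q y z) a b (u ∘ e) := by
  classical
  obtain ⟨Q, hQ0, hQ1, hQ2, hQL, hu⟩ := exists_harmonicMeasure h0 hs hc he
  refine ⟨Q, hQ0, hQ1, hQ2, hQL, ?_, ?_⟩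
  · intro x y
    by_cases hxy : x = y
    · rw [hxy]
    have hval : ∀ x y, x ≠ y → laplacian c (Q y) (e x) = -∑ z, c (e x) z * Q y z := by
      intro x y h
      rw [laplacian_eq_sum, hQ2 x y h, ← Finset.sum_neg_distrib]
      exact Finset.sum_congr rfl fun z _ => by ring
    -- `Q x` vanishes on the image except at `e x`, and the Laplacian of `Q y` vanishes off the
    -- image, so one term survives. Symmetry of the trace is then symmetry of the energy form.
    have hform : ∀ x y, ∑ z, Q x z * laplacian c (Q y) z = laplacian c (Q y) (e x) := by
      intro x y
      rw [Finset.sum_eq_single (e x), hQ1, one_mul]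
      · intro z _ hz
        by_cases hr : z ∈ Set.range e
        · obtain ⟨w, rfl⟩ := hr
          rw [hQ2 w x fun h => hz (h ▸ rfl), zero_mul]
        · rw [hQL y z hr, mul_zero]
      · simp
    have hsymm : energyForm c (Q x) (Q y) = energyForm c (Q y) (Q x) := by
      simp only [energyForm, mul_comm (Q x _ - Q x _)]
    rw [← sum_mul_laplacian hs, ← sum_mul_laplacian hs, hform, hform, hval x y hxy,
      hval y x (Ne.symm hxy)] at hsymm
    linarith
  · intro a b u hpot x
    have hharm : ∀ z ∉ Set.range e, laplacian c u z = 0 := by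
      intro z hz
      rw [hpot z, if_neg fun h => hz ⟨a, h.symm⟩, if_neg fun h => hz ⟨b, h.symm⟩, sub_zero]
    have h1 := hu u hharm
    have h2 : ∀ z, 1 = ∑ y, Q y z := by
      simpa using hu (fun _ => 1) fun z _ => by simp [laplacian_eq_sum]
    have key : laplacian (fun x y => ∑ z, c (e x) z * Q y z) (u ∘ e) x = laplacian c u (e x) := by
      simp only [laplacian_eq_sum, Finset.sum_mul, Function.comp_apply]
      rw [Finset.sum_comm]
      refine Finset.sum_congr rfl fun z _ => ?_
      have h3 : u (e x) - u z = ∑ y, Q y z * (u (e x) - u (e y)) := by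
        simp only [mul_sub, Finset.sum_sub_distrib, ← Finset.sum_mul, ← h2, ← h1, one_mul]
      rw [h3, Finset.mul_sum]
      exact Finset.sum_congr rfl fun y _ => by ring
    rw [key, hpot (e x)]
    simp only [he.eq_iff]

end Finite

end TraceRes

namespace TraceRes

open scoped ENNReal

/-! ### Substochastic kernels with values in `[0, ∞]`. -/

section Kernel

variable {α : Type*}

/-- The action of a kernel with values in `[0, ∞]` on functions. -/
noncomputable def kernelOp (P : α → α → ℝ≥0∞) (f : α → ℝ≥0∞) (s : α) : ℝ≥0∞ :=
  ∑' t, P s t * f t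

theorem iterate_kernelOp_eq_tsum [DecidableEq α] (P : α → α → ℝ≥0∞) (f : α → ℝ≥0∞) (n : ℕ)
    (s : α) : (kernelOp P)^[n] f s = ∑' t, (kernelOp P)^[n] (Pi.single t 1) s * f t := by
  induction n generalizing s with
  | zero =>
    rw [tsum_eq_single s fun t ht => by simp [Pi.single_eq_of_ne ht.symm]]
    simp
  | succ n ih =>
    simp only [Function.iterate_succ_apply', kernelOp, ih, ← ENNReal.tsum_mul_left,
      ← ENNReal.tsum_mul_right]
    rw [ENNReal.tsum_comm]
    simp only [mul_assoc]

theorem iterate_kernelOp_le_one {P : α → α → ℝ≥0∞} (hP : ∀ s, ∑' t, P s t ≤ 1)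
    {f : α → ℝ≥0∞} (hf : ∀ s, f s ≤ 1) (n : ℕ) (s : α) : (kernelOp P)^[n] f s ≤ 1 := by
  induction n generalizing s with
  | zero => exact hf s
  | succ n ih =>
    rw [Function.iterate_succ_apply']
    exact (ENNReal.tsum_le_tsum fun t => mul_le_of_le_one_right' (ih t)).trans (hP s)

/-- Substochasticity keeps every iterate at most `1`, so no infinite term spoils the passage to real
sums. -/
theorem infPow_eq_toReal [DecidableEq α] {P : α → α → ℝ≥0∞} (hP : ∀ s, ∑' t, P s t ≤ 1)
    {M : Matrix α α ℝ} (hM : ∀ s t, M s t = (P s t).toReal) (n : ℕ) (s t : α) :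
    infPow M n s t = ((kernelOp P)^[n] (Pi.single t 1) s).toReal := by
  have hone : ∀ s, (Pi.single t 1 : α → ℝ≥0∞) s ≤ 1 := fun s => by
    rw [Pi.single_apply]
    split_ifs <;> simp
  induction n generalizing s with
  | zero =>
    simp only [infPow, Function.iterate_zero, id, Matrix.one_apply, Pi.single_apply]
    split_ifs <;> simp
  | succ n ih =>
    rw [Function.iterate_succ_apply', kernelOp, ENNReal.tsum_toReal_eq]
    · simp only [infPow, infMul, hM, ih, ENNReal.toReal_mul]
    · intro u
      refine ne_top_of_le_ne_top ENNReal.one_ne_top (mul_le_one' ?_ ?_)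
      · exact (ENNReal.le_tsum u).trans (hP s)
      · exact iterate_kernelOp_le_one hP hone n u

/-- Minimality of the Green potential: partial sums satisfy `S (n + 1) = f + P (S n)`, so the bound
by `g` propagates. -/
theorem tsum_iterate_kernelOp_le {P : α → α → ℝ≥0∞} {f g : α → ℝ≥0∞}
    (hg : ∀ s, f s + kernelOp P g s ≤ g s) (s : α) : ∑' n, (kernelOp P)^[n] f s ≤ g s := by
  refine ENNReal.tsum_le_of_sum_range_le fun n => ?_
  induction n generalizing s with
  | zero => simp
  | succ n ih =>
    rw [Finset.sum_range_succ']
    refine le_trans ?_ (hg s)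
    rw [add_comm]
    refine add_le_add le_rfl ?_
    simp only [Function.iterate_succ_apply', kernelOp]
    rw [← Summable.tsum_finsetSum fun _ _ => ENNReal.summable]
    refine ENNReal.tsum_le_tsum fun t => ?_
    rw [← Finset.mul_sum]
    exact mul_le_mul_right (ih t) _

/-- Detailed balance makes the kernel self-adjoint for the weight `w`, hence also its iterates. -/
theorem tsum_mul_iterate_kernelOp_comm {P : α → α → ℝ≥0∞} {w : α → ℝ≥0∞}
    (hw : ∀ s t, w s * P s t = w t * P t s) (f g : α → ℝ≥0∞) (n : ℕ) :
    ∑' s, w s * f s * (kernelOp P)^[n] g s = ∑' s, w s * g s * (kernelOp P)^[n] f s := by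
  have hadj : ∀ f g : α → ℝ≥0∞,
      ∑' s, w s * f s * kernelOp P g s = ∑' s, w s * kernelOp P f s * g s := by
    intro f g
    simp only [kernelOp, ← ENNReal.tsum_mul_left, ← ENNReal.tsum_mul_right]
    rw [ENNReal.tsum_comm]
    refine tsum_congr fun t => tsum_congr fun s => ?_
    calc w s * f s * (P s t * g t) = w s * P s t * (f s * g t) := by ring
      _ = w t * (P t s * f s) * g t := by rw [hw]; ring
  have hiter : ∀ f g : α → ℝ≥0∞,
      ∑' s, w s * f s * (kernelOp P)^[n] g s = ∑' s, w s * (kernelOp P)^[n] f s * g s := by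
    induction n with
    | zero => simp
    | succ n ih =>
      intro f g
      rw [Function.iterate_succ_apply', hadj, ih, Function.iterate_succ_apply]
  rw [hiter]
  exact tsum_congr fun s => by ring

/-- Fatou's lemma for counting measure. -/
theorem tsum_liminf_le {f : ℕ → α → ℝ≥0∞} :
    ∑' s, liminf (fun k => f k s) atTop ≤ liminf (fun k => ∑' s, f k s) atTop := by
  let _ : MeasurableSpace α := ⊤
  have := MeasureTheory.lintegral_liminf_le (μ := MeasureTheory.Measure.count) (f := f) (u := atTop)
    fun n => measurable_from_top
  simpa only [MeasureTheory.lintegral_count] using this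

theorem tsum_mul_liminf_le {f : ℕ → α → ℝ≥0∞} {w : α → ℝ≥0∞} (hw : ∀ s, w s ≠ ∞) :
    ∑' s, w s * liminf (fun k => f k s) atTop ≤ liminf (fun k => ∑' s, w s * f k s) atTop := by
  refine le_trans (le_of_eq (tsum_congr fun s => ?_)) tsum_liminf_le
  exact (ENNReal.liminf_const_mul_of_ne_top (hw s)).symm

end Kernel

/-! ### Hitting probabilities and the conductances of the trace network. -/

namespace Network

variable {V : Type*} (N : Network V)

theorem totalCond_nonneg (x : V) : 0 ≤ N.totalCond x := tsum_nonneg (N.nonneg x)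

theorem cond_le_totalCond (x y : V) : N.cond x y ≤ N.totalCond x :=
  (N.summable x).le_tsum y fun z _ => N.nonneg x z

theorem trans_nonneg (x y : V) : 0 ≤ N.trans x y :=
  div_nonneg (N.nonneg x y) (N.totalCond_nonneg x)

theorem totalCond_mul_trans (x y : V) : N.totalCond x * N.trans x y = N.cond x y := by
  rcases eq_or_ne (N.totalCond x) 0 with h | h
  · have h1 := N.cond_le_totalCond x y
    have h2 := N.nonneg x y
    rw [h] at h1 ⊢
    linarith
  · exact mul_div_cancel₀ _ h

/-- The transition probabilities as elements of `[0, ∞]`. -/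
noncomputable def etrans (x y : V) : ℝ≥0∞ := ENNReal.ofReal (N.trans x y)

theorem tsum_etrans_le_one (x : V) : ∑' y, N.etrans x y ≤ 1 := by
  simp only [etrans]
  rw [← ENNReal.ofReal_tsum_of_nonneg (N.trans_nonneg x) ((N.summable x).div_const _),
    ENNReal.ofReal_le_one]
  simp only [trans]
  rw [tsum_div_const]
  exact div_self_le_one _

variable (H : Set V)

theorem tsum_etrans_compl_le_one (s : (Hᶜ : Set V)) :
    ∑' t : (Hᶜ : Set V), N.etrans s t ≤ 1 :=
  (ENNReal.tsum_comp_le_tsum_of_injective Subtype.val_injective _).trans (N.tsum_etrans_le_one s)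

/-- The operator of the walk killed on `H`. -/
noncomputable def killedOp : ((Hᶜ : Set V) → ℝ≥0∞) → (Hᶜ : Set V) → ℝ≥0∞ :=
  kernelOp fun s t => N.etrans s t

/-- The probability that the walk from `s` enters `H` at `y`. -/
noncomputable def hitting (y : V) (s : (Hᶜ : Set V)) : ℝ≥0∞ :=
  ∑' n, (N.killedOp H)^[n] (fun t => N.etrans t y) s

theorem add_tsum_compl_le_tsum (y : H) (f : V → ℝ≥0∞) :
    f y + ∑' t : (Hᶜ : Set V), f t ≤ ∑' t, f t := by
  rw [← ENNReal.summable.tsum_add_tsum_compl (s := H) ENNReal.summable]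
  exact add_le_add (ENNReal.le_tsum (f := fun t : H => f t) y) le_rfl

theorem hitting_le_of_superharmonic (y : H) {g : V → ℝ≥0∞} (hy : 1 ≤ g y)
    (hg : ∀ s ∉ H, ∑' t, N.etrans s t * g t ≤ g s) (s : (Hᶜ : Set V)) :
    N.hitting H y s ≤ g s := by
  refine tsum_iterate_kernelOp_le (P := fun s t : (Hᶜ : Set V) => N.etrans s t)
    (f := fun t => N.etrans t y) (g := fun s => g s) (fun s => ?_) s
  refine le_trans ?_ (hg s s.2)
  refine le_trans (add_le_add ?_ le_rfl)
    (add_tsum_compl_le_tsum H y fun t => N.etrans s t * g t)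
  exact le_mul_of_one_le_right' hy

theorem hitting_le_one (y : H) (s : (Hᶜ : Set V)) : N.hitting H y s ≤ 1 :=
  N.hitting_le_of_superharmonic H y (g := fun _ => 1) le_rfl
    (fun s _ => by simpa using N.tsum_etrans_le_one s) s

/-- The conductances of the trace network with values in `[0, ∞]`. -/
noncomputable def etraceCond (x y : V) : ℝ≥0∞ :=
  ENNReal.ofReal (N.cond x y) +
    ∑' s : (Hᶜ : Set V), ENNReal.ofReal (N.cond x s) * N.hitting H y s

theorem etraceCond_ne_top (x : V) (y : H) : N.etraceCond H x y ≠ ∞ := by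
  refine ENNReal.add_ne_top.2 ⟨ENNReal.ofReal_ne_top, ?_⟩
  refine ne_top_of_le_ne_top (ENNReal.ofReal_ne_top (r := N.totalCond x)) ?_
  rw [totalCond, ENNReal.ofReal_tsum_of_nonneg (N.nonneg x) (N.summable x)]
  refine le_trans (ENNReal.tsum_le_tsum fun s => mul_le_of_le_one_right' (N.hitting_le_one H y s)) ?_
  exact ENNReal.tsum_comp_le_tsum_of_injective Subtype.val_injective
    fun z => ENNReal.ofReal (N.cond x z)

/-- Reversibility: an excursion through the complement and its reversal carry the same weight. -/
theorem etraceCond_comm (x y : V) : N.etraceCond H x y = N.etraceCond H y x := by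
  have hw : ∀ s t, ENNReal.ofReal (N.totalCond s) * N.etrans s t = ENNReal.ofReal (N.cond s t) :=
    fun s t => by
      rw [etrans, ← ENNReal.ofReal_mul (N.totalCond_nonneg s), N.totalCond_mul_trans]
  have h : ∀ x y, ∑' s : (Hᶜ : Set V), ENNReal.ofReal (N.cond x s) * N.hitting H y s
      = ∑' n, ∑' s : (Hᶜ : Set V), ENNReal.ofReal (N.totalCond s) * N.etrans s x *
        (N.killedOp H)^[n] (fun t => N.etrans t y) s := by
    intro x y
    rw [ENNReal.tsum_comm]
    refine tsum_congr fun s => ?_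
    rw [ENNReal.tsum_mul_left, hw, N.symm s x, hitting]
  rw [etraceCond, etraceCond, h, h, N.symm x y]
  congr 1
  refine tsum_congr fun n => ?_
  refine tsum_mul_iterate_kernelOp_comm (w := fun s : (Hᶜ : Set V) => ENNReal.ofReal (N.totalCond s))
    (fun s t => ?_) (fun t => N.etrans t x) (fun t => N.etrans t y) n
  rw [hw, hw, N.symm]

theorem infMul_blockDInv_blockB (s : (Hᶜ : Set V)) (y : H) :
    infMul (N.blockDInv H) (N.blockB H) s y = -(N.hitting H y s).toReal := by
  classical
  have hsum : N.hitting H y s = ∑' t : (Hᶜ : Set V),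
      (∑' n, (N.killedOp H)^[n] (Pi.single t 1) s) * N.etrans t y := by
    simp only [← ENNReal.tsum_mul_right]
    rw [ENNReal.tsum_comm]
    exact tsum_congr fun n => iterate_kernelOp_eq_tsum _ _ n s
  -- The Green value may be infinite only where the factor `N.etrans t y` vanishes, so reading it as
  -- `0` in the reals leaves the product correct.
  have hfin : ∀ t : (Hᶜ : Set V),
      (∑' n, (N.killedOp H)^[n] (Pi.single t 1) s) * N.etrans t y ≠ ∞ := fun t =>
    ne_top_of_le_ne_top ENNReal.one_ne_top
      ((ENNReal.le_tsum t).trans (hsum.symm.trans_le (N.hitting_le_one H y s)))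
  have hpow : ∀ n t, infPow (N.transD H) n s t
      = ((N.killedOp H)^[n] (Pi.single t 1) s).toReal := fun n t => by
    refine infPow_eq_toReal (N.tsum_etrans_compl_le_one H) (fun s t => ?_) n s t
    rw [etrans, ENNReal.toReal_ofReal (N.trans_nonneg _ _), transD]
  have hone : ∀ n (t : (Hᶜ : Set V)), (N.killedOp H)^[n] (Pi.single t 1) s ≠ ∞ := fun n t =>
    ne_top_of_le_ne_top ENNReal.one_ne_top
      (iterate_kernelOp_le_one (N.tsum_etrans_compl_le_one H) (fun s => by
        rw [Pi.single_apply]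
        split_ifs <;> simp) n s)
  rw [hsum, ENNReal.tsum_toReal_eq hfin, infMul, ← tsum_neg]
  refine tsum_congr fun t => ?_
  rw [ENNReal.toReal_mul, ENNReal.tsum_toReal_eq fun n => hone n t, blockDInv, blockB, lapMatrix,
    if_neg fun h : (t : V) = y => t.2 (h ▸ y.2), etrans,
    ENNReal.toReal_ofReal (N.trans_nonneg _ _), trans]
  simp only [hpow]
  ring

theorem traceCond_eq_toReal {x y : H} (h : x ≠ y) :
    N.traceCond H x y = (N.etraceCond H x y).toReal := by
  have hfin := N.etraceCond_ne_top H x y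
  rw [etraceCond] at hfin ⊢
  have hfin' := (ENNReal.add_ne_top.1 hfin).2
  rw [ENNReal.toReal_add ENNReal.ofReal_ne_top hfin', ENNReal.toReal_ofReal (N.nonneg _ _),
    ENNReal.tsum_toReal_eq (ENNReal.ne_top_of_tsum_ne_top hfin'), traceCond, if_neg h, schur,
    Matrix.sub_apply, blockA, lapMatrix, if_neg fun h' => h (Subtype.ext h')]
  rw [infMul]
  simp only [infMul_blockDInv_blockB, ENNReal.toReal_mul, ENNReal.toReal_ofReal (N.nonneg _ _)]
  have : ∀ s : (Hᶜ : Set V), N.blockBT H x s * -(N.hitting H y s).toReal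
      = N.cond x s * (N.hitting H y s).toReal := fun s => by
    rw [blockBT, lapMatrix, if_neg fun h : (x : V) = s => s.2 (h ▸ x.2)]
    ring
  simp only [this]
  ring

theorem traceCond_self (x : H) : N.traceCond H x x = 0 := if_pos rfl

theorem traceCond_comm (x y : H) : N.traceCond H x y = N.traceCond H y x := by
  rcases eq_or_ne x y with rfl | h
  · rfl
  · rw [N.traceCond_eq_toReal H h, N.traceCond_eq_toReal H h.symm, etraceCond_comm]

theorem freeCond_le_traceCond (x y : H) : N.freeCond H x y ≤ N.traceCond H x y := by
  rcases eq_or_ne x y with rfl | h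
  · rw [traceCond_self, freeCond, N.no_loop]
  · rw [N.traceCond_eq_toReal H h, freeCond,
      ← ENNReal.ofReal_le_iff_le_toReal (N.etraceCond_ne_top H x y)]
    exact le_self_add

theorem traceCond_nonneg (x y : H) : 0 ≤ N.traceCond H x y :=
  (N.nonneg x y).trans (N.freeCond_le_traceCond H x y)

theorem isConnected_traceCond (h : IsConnected (N.freeCond H)) : IsConnected (N.traceCond H) :=
  fun x y => Relation.ReflTransGen.mono
    (fun u v huv => lt_of_lt_of_le huv (N.freeCond_le_traceCond H u v)) x y (h x y)

/-- Fatou enters twice: it makes the liminf of the `q k` superharmonic off `H`, so that it dominates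
the hitting probability, and then moves the liminf out of the sum over `z`. -/
theorem etraceCond_le_liminf (x y : H) {q : ℕ → V → ℝ≥0∞} (hy : ∀ᶠ k in atTop, 1 ≤ q k y)
    (hq : ∀ s ∉ H, ∀ᶠ k in atTop, ∑' t, N.etrans s t * q k t ≤ q k s) :
    N.etraceCond H x y ≤ liminf (fun k => ∑' z, ENNReal.ofReal (N.cond x z) * q k z) atTop := by
  set g : V → ℝ≥0∞ := fun z => liminf (fun k => q k z) atTop with hg
  have hgy : 1 ≤ g y := le_liminf_of_le (by isBoundedDefault) hy
  have hgs : ∀ s ∉ H, ∑' t, N.etrans s t * g t ≤ g s := fun s hs =>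
    (tsum_mul_liminf_le fun _ => ENNReal.ofReal_ne_top).trans (liminf_le_liminf (hq s hs))
  have hhit := N.hitting_le_of_superharmonic H y hgy hgs
  refine le_trans ?_ (tsum_mul_liminf_le fun _ => ENNReal.ofReal_ne_top)
  refine le_trans (add_le_add (le_mul_of_one_le_right' hgy)
    (ENNReal.tsum_le_tsum fun s => mul_le_mul_right (hhit s) _)) ?_
  exact add_tsum_compl_le_tsum H y fun z => ENNReal.ofReal (N.cond x z) * g z

end Network

end TraceRes

namespace TraceRes

open scoped ENNReal

/-! ### Comparison of free and trace resistances along an exhaustion. -/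

namespace Network

variable {V : Type*} (N : Network V)

theorem freeCond_nonneg (H : Set V) (x y : H) : 0 ≤ N.freeCond H x y := N.nonneg x y

theorem freeCond_comm (H : Set V) (x y : H) : N.freeCond H x y = N.freeCond H y x := N.symm x y

theorem freeResistanceOn_eq {H : Finset V} {a b : V} (ha : a ∈ (H : Set V)) (hb : b ∈ (H : Set V)) :
    N.freeResistanceOn H a b = effectiveResistance (N.freeCond (H : Set V)) ⟨a, ha⟩ ⟨b, hb⟩ :=
  dif_pos ⟨ha, hb⟩

theorem traceResistanceOn_eq {H : Finset V} {a b : V} (ha : a ∈ (H : Set V))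
    (hb : b ∈ (H : Set V)) :
    N.traceResistanceOn H a b = effectiveResistance (N.traceCond (H : Set V)) ⟨a, ha⟩ ⟨b, hb⟩ :=
  dif_pos ⟨ha, hb⟩

theorem freeResistanceOn_anti {H K : Finset V} (hH : IsConnected (N.freeCond (H : Set V)))
    (hK : IsConnected (N.freeCond (K : Set V))) (hHK : H ⊆ K) {a b : V} (ha : a ∈ H)
    (hb : b ∈ H) : N.freeResistanceOn K a b ≤ N.freeResistanceOn H a b := by
  obtain ⟨u, hu⟩ := exists_isUnitPotential (N.freeCond_nonneg K) (N.freeCond_comm K) hK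
    ⟨a, hHK ha⟩ ⟨b, hHK hb⟩
  rw [N.freeResistanceOn_eq (hHK ha) (hHK hb), N.freeResistanceOn_eq ha hb,
    ← one_mul (effectiveResistance (N.freeCond (H : Set V)) _ _)]
  exact effectiveResistance_le_mul (N.freeCond_nonneg H) (N.freeCond_comm H) hH
    (N.freeCond_nonneg K) (N.freeCond_comm K)
    (e := Set.inclusion (Finset.coe_subset.2 hHK)) (Set.inclusion_injective _) zero_le_one
    (fun x y => (one_mul (N.cond x y)).ge) (a := ⟨a, ha⟩) (b := ⟨b, hb⟩) hu

theorem traceResistanceOn_le_freeResistanceOn {H : Finset V}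
    (hH : IsConnected (N.freeCond (H : Set V))) {a b : V} (ha : a ∈ H) (hb : b ∈ H) :
    N.traceResistanceOn H a b ≤ N.freeResistanceOn H a b := by
  obtain ⟨u, hu⟩ := exists_isUnitPotential (N.traceCond_nonneg H) (N.traceCond_comm H)
    (N.isConnected_traceCond H hH) ⟨a, ha⟩ ⟨b, hb⟩
  rw [N.freeResistanceOn_eq ha hb, N.traceResistanceOn_eq ha hb,
    ← one_mul (effectiveResistance (N.freeCond (H : Set V)) _ _)]
  exact effectiveResistance_le_mul (N.freeCond_nonneg H) (N.freeCond_comm H) hH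
    (N.traceCond_nonneg H) (N.traceCond_comm H) (e := id) Function.injective_id zero_le_one
    (fun x y => by simpa using N.freeCond_le_traceCond H x y) hu

theorem freeResistanceOn_nonneg {H : Finset V} (hH : IsConnected (N.freeCond (H : Set V)))
    (a b : V) : 0 ≤ N.freeResistanceOn H a b := by
  rw [freeResistanceOn]
  split_ifs
  · exact effectiveResistance_nonneg (N.freeCond_nonneg H) (N.freeCond_comm H) hH _ _
  · rfl

theorem exists_harmonicMeasure_finset {H K : Finset V} (hK : IsConnected (N.freeCond (K : Set V)))
    (hHK : H ⊆ K) (hne : H.Nonempty) :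
    ∃ Q : ↥(H : Set V) → V → ℝ, (∀ y z, 0 ≤ Q y z) ∧ (∀ y, Q y y = 1) ∧
      (∀ y, ∀ z ∉ K, Q y z = 0) ∧
      (∀ y, ∀ s ∈ K, s ∉ H → ∑ z ∈ K, N.cond s z * (Q y s - Q y z) = 0) ∧
      ∀ c : ↥(H : Set V) → ↥(H : Set V) → ℝ, (∀ x y, 0 ≤ c x y) → (∀ x y, c x y = c y x) →
        IsConnected c → ∀ r : ℝ, 0 ≤ r →
        (∀ x y, c x y ≤ r * ∑ z ∈ K, N.cond x z * Q y z) →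
        ∀ a b : (H : Set V), N.freeResistanceOn K a b ≤ r * effectiveResistance c a b := by
  classical
  have : Nonempty (H : Set V) := hne.to_subtype
  obtain ⟨Q, hQ0, hQ1, -, hQL, hsymm, hpot⟩ := isUnitPotential_trace
    (N.freeCond_nonneg K) (N.freeCond_comm K) hK
    (e := Set.inclusion (Finset.coe_subset.2 hHK)) (Set.inclusion_injective _)
  have hext : ∀ (y : (H : Set V)) (z : (K : Set V)),
      (if h : (z : V) ∈ (K : Set V) then Q y ⟨z, h⟩ else 0) = Q y z := fun y z => dif_pos z.2
  refine ⟨fun y z => if h : z ∈ (K : Set V) then Q y ⟨z, h⟩ else 0, ?_, ?_, ?_, ?_, ?_⟩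
  · intro y z
    dsimp only
    split_ifs
    · exact hQ0 _ _
    · rfl
  · exact fun y => (hext y ⟨y, hHK y.2⟩).trans (hQ1 y)
  · exact fun y z hz => dif_neg hz
  · intro y s hs hsH
    have h1 := hQL y ⟨s, hs⟩ (by
      rintro ⟨x, hx⟩
      have hxs : (x : V) = s := congrArg Subtype.val hx
      exact hsH (hxs ▸ x.2))
    rw [laplacian_eq_sum] at h1
    rw [← Finset.sum_finset_coe]
    refine (Finset.sum_congr rfl fun z _ => ?_).trans h1
    dsimp only
    rw [hext, hext y ⟨s, hs⟩]
    rfl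
  · intro c h0 hs hc r hr hle a b
    have hM : ∀ x y : (H : Set V),
        ∑ z ∈ K, N.cond x z * (if h : z ∈ (K : Set V) then Q y ⟨z, h⟩ else 0)
        = ∑ z, N.freeCond K (Set.inclusion (Finset.coe_subset.2 hHK) x) z * Q y z := by
      intro x y
      rw [← Finset.sum_finset_coe]
      refine Finset.sum_congr rfl fun z _ => ?_
      rw [hext]
      rfl
    simp only [hM] at hle
    obtain ⟨u, hu⟩ := exists_isUnitPotential (N.freeCond_nonneg K) (N.freeCond_comm K) hK
      (Set.inclusion (Finset.coe_subset.2 hHK) a) (Set.inclusion (Finset.coe_subset.2 hHK) b)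
    have hu' := hpot a b u hu
    rw [N.freeResistanceOn_eq (hHK a.2) (hHK b.2)]
    refine (hu.effectiveResistance_eq (N.freeCond_comm K)).trans_le ?_
    refine (hu'.effectiveResistance_eq hsymm).symm.trans_le ?_
    exact effectiveResistance_le_mul h0 hs hc
      (fun x y => Finset.sum_nonneg fun z _ => mul_nonneg (N.freeCond_nonneg K _ _) (hQ0 y z))
      hsymm (e := id) Function.injective_id hr hle hu'

theorem tsum_ofReal_mul_ofReal {K : Finset V} {f g : V → ℝ} (hf : ∀ z, 0 ≤ f z)
    (hg : ∀ z, 0 ≤ g z) (hK : ∀ z ∉ K, g z = 0) :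
    ∑' z, ENNReal.ofReal (f z) * ENNReal.ofReal (g z) = ENNReal.ofReal (∑ z ∈ K, f z * g z) := by
  rw [tsum_eq_sum fun z hz => by rw [hK z hz, ENNReal.ofReal_zero, mul_zero],
    ENNReal.ofReal_sum_of_nonneg fun z _ => mul_nonneg (hf z) (hg z)]
  exact Finset.sum_congr rfl fun z _ => (ENNReal.ofReal_mul (hf z)).symm

/-- Harmonicity inside `K` normalizes by the conductance staying in `K`, which is at most
`N.totalCond s`; the edges leaving `K` turn equality into an inequality. -/
theorem sum_trans_mul_le {K : Finset V} {q : V → ℝ} (hq : ∀ z, 0 ≤ q z) {s : V}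
    (hs : ∑ z ∈ K, N.cond s z * (q s - q z) = 0) : ∑ z ∈ K, N.trans s z * q z ≤ q s := by
  have h1 : ∑ z ∈ K, N.trans s z * q z = (∑ z ∈ K, N.cond s z) * q s / N.totalCond s := by
    simp only [mul_sub, Finset.sum_sub_distrib, sub_eq_zero, ← Finset.sum_mul] at hs
    rw [hs, Finset.sum_div]
    exact Finset.sum_congr rfl fun z _ => by rw [trans]; ring
  rw [h1]
  refine div_le_of_le_mul₀ (N.totalCond_nonneg s) (hq s) ?_
  rw [mul_comm (q s)]
  exact mul_le_mul_of_nonneg_right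
    ((N.summable s).sum_le_tsum K fun z _ => N.nonneg s z) (hq s)

variable {N}

theorem IsExhaustion.eventually_subset {G : ℕ → Finset V} (hG : N.IsExhaustion G)
    (K : Finset V) : ∀ᶠ k in atTop, K ⊆ G k := by
  have h : ∀ x ∈ K, ∀ᶠ k in atTop, x ∈ G k := fun x _ => by
    obtain ⟨k, hk⟩ := hG.cover x
    exact (eventually_ge_atTop k).mono fun j hj => hG.mono hj hk
  filter_upwards [(Finset.eventually_all K).2 h] with k hk x hx using hk x hx

theorem IsExhaustion.eventually_freeResistanceOn_le {G : ℕ → Finset V} (hG : N.IsExhaustion G)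
    {H : Finset V} (hH : IsConnected (N.freeCond (H : Set V))) {a b : V} (ha : a ∈ H) (hb : b ∈ H)
    {r : ℝ} (hr : 1 < r) :
    ∀ᶠ k in atTop, N.freeResistanceOn (G k) a b ≤ r * N.traceResistanceOn H a b := by
  have hr0 : 0 < r := one_pos.trans hr
  have hQ : ∀ k, ∃ Q : ↥(H : Set V) → V → ℝ, H ⊆ G k → (∀ y z, 0 ≤ Q y z) ∧ (∀ y, Q y y = 1) ∧
      (∀ y, ∀ z ∉ G k, Q y z = 0) ∧
      (∀ y, ∀ s ∈ G k, s ∉ H → ∑ z ∈ G k, N.cond s z * (Q y s - Q y z) = 0) ∧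
      ∀ c : ↥(H : Set V) → ↥(H : Set V) → ℝ, (∀ x y, 0 ≤ c x y) → (∀ x y, c x y = c y x) →
        IsConnected c → ∀ r : ℝ, 0 ≤ r →
        (∀ x y, c x y ≤ r * ∑ z ∈ G k, N.cond x z * Q y z) →
        ∀ a b : (H : Set V), N.freeResistanceOn (G k) a b ≤ r * effectiveResistance c a b := by
    intro k
    by_cases hk : H ⊆ G k
    · obtain ⟨Q, h⟩ := N.exists_harmonicMeasure_finset (hG.connected k) hk ⟨a, ha⟩
      exact ⟨Q, fun _ => h⟩
    · exact ⟨0, fun h => absurd h hk⟩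
  choose Q hQ using hQ
  have hsub := hG.eventually_subset H
  have hlim : ∀ x y : (H : Set V), N.etraceCond H x y
      ≤ liminf (fun k => ∑' z, ENNReal.ofReal (N.cond x z) * ENNReal.ofReal (Q k y z)) atTop := by
    intro x y
    refine N.etraceCond_le_liminf (H : Set V) x y (q := fun k z => ENNReal.ofReal (Q k y z)) ?_ ?_
    · filter_upwards [hsub] with k hk
      rw [(hQ k hk).2.1 y, ENNReal.ofReal_one]
    · intro s hs
      filter_upwards [hsub, hG.eventually_subset {s}] with k hk hsk
      obtain ⟨h0, -, h2, h3, -⟩ := hQ k hk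
      simp only [etrans]
      rw [tsum_ofReal_mul_ofReal (N.trans_nonneg s) (h0 y) (h2 y)]
      exact ENNReal.ofReal_le_ofReal
        (N.sum_trans_mul_le (h0 y) (h3 y s (Finset.singleton_subset_iff.1 hsk) hs))
  have hle : ∀ᶠ k in atTop, ∀ x y : (H : Set V),
      N.traceCond H x y ≤ r * ∑ z ∈ G k, N.cond x z * Q k y z := by
    rw [eventually_all]
    intro x
    rw [eventually_all]
    intro y
    -- Only a positive conductance drops strictly on division by `r`, and strictness is what turns
    -- the liminf bound into an eventual one; finitely many pairs make it uniform.
    rcases (N.traceCond_nonneg H x y).eq_or_lt with h | h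
    · filter_upwards [hsub] with k hk
      rw [← h]
      exact mul_nonneg hr0.le
        (Finset.sum_nonneg fun z _ => mul_nonneg (N.nonneg x z) ((hQ k hk).1 y z))
    · have hxy : x ≠ y := by
        rintro rfl
        simp [traceCond_self] at h
      have hlt : ENNReal.ofReal (N.traceCond H x y / r) < N.etraceCond H x y := by
        rw [ENNReal.ofReal_lt_iff_lt_toReal (div_nonneg h.le hr0.le) (N.etraceCond_ne_top H x y),
          ← N.traceCond_eq_toReal H hxy]
        exact div_lt_self h hr
      filter_upwards [hsub, eventually_lt_of_lt_liminf (hlt.trans_le (hlim x y))] with k hk hk'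
      obtain ⟨h0, -, h2, -⟩ := hQ k hk
      rw [tsum_ofReal_mul_ofReal (N.nonneg x) (h0 y) (h2 y)] at hk'
      have := (ENNReal.ofReal_lt_ofReal_iff_of_nonneg (div_nonneg h.le hr0.le)).1 hk'
      rw [div_lt_iff₀ hr0] at this
      linarith
  filter_upwards [hsub, hle] with k hk hk'
  rw [N.traceResistanceOn_eq ha hb]
  exact (hQ k hk).2.2.2.2 _ (N.traceCond_nonneg H) (N.traceCond_comm H)
    (N.isConnected_traceCond H hH) r hr0.le hk' ⟨a, ha⟩ ⟨b, hb⟩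

variable (N)

/-- The infimum of the free resistances of the finite connected subnetworks. -/
noncomputable def freeResistanceInf (a b : V) : ℝ :=
  sInf {r | ∃ K : Finset V, IsConnected (N.freeCond (K : Set V)) ∧ a ∈ K ∧ b ∈ K ∧
    N.freeResistanceOn K a b = r}

theorem freeResistanceInf_le {K : Finset V} (hK : IsConnected (N.freeCond (K : Set V))) {a b : V}
    (ha : a ∈ K) (hb : b ∈ K) : N.freeResistanceInf a b ≤ N.freeResistanceOn K a b := by
  refine csInf_le ⟨0, ?_⟩ ⟨K, hK, ha, hb, rfl⟩
  rintro _ ⟨K, hK, -, -, rfl⟩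
  exact N.freeResistanceOn_nonneg hK a b

variable {N}

theorem IsExhaustion.eventually_mem {G : ℕ → Finset V} (hG : N.IsExhaustion G) (a b : V) :
    ∀ᶠ k in atTop, a ∈ G k ∧ b ∈ G k := by
  classical
  filter_upwards [hG.eventually_subset {a, b}] with k hk
  exact ⟨hk (by simp), hk (by simp)⟩

theorem IsExhaustion.tendsto_freeResistanceOn {G : ℕ → Finset V} (hG : N.IsExhaustion G)
    (a b : V) :
    Tendsto (fun k => N.freeResistanceOn (G k) a b) atTop (𝓝 (N.freeResistanceInf a b)) := by
  have hmem := hG.eventually_mem a b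
  refine tendsto_order.2 ⟨fun r hr => ?_, fun r hr => ?_⟩
  · filter_upwards [hmem] with k hk
    exact hr.trans_le (N.freeResistanceInf_le (hG.connected k) hk.1 hk.2)
  · obtain ⟨k, hk⟩ := hmem.exists
    -- A near-optimal `K` is eventually contained in the exhaustion, whichever one it is; hence the
    -- limit does not depend on it.
    obtain ⟨_, ⟨K, hK, ha, hb, rfl⟩, hlt⟩ :=
      exists_lt_of_csInf_lt (s := {r | ∃ K : Finset V, IsConnected (N.freeCond (K : Set V)) ∧
        a ∈ K ∧ b ∈ K ∧ N.freeResistanceOn K a b = r}) ⟨_, G k, hG.connected k, hk.1, hk.2, rfl⟩ hr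
    filter_upwards [hG.eventually_subset K] with j hj
    exact (N.freeResistanceOn_anti hK (hG.connected j) hj ha hb).trans_lt hlt

theorem IsExhaustion.tendsto_traceResistanceOn {G : ℕ → Finset V} (hG : N.IsExhaustion G)
    (a b : V) :
    Tendsto (fun k => N.traceResistanceOn (G k) a b) atTop (𝓝 (N.freeResistanceInf a b)) := by
  have hmem := hG.eventually_mem a b
  refine tendsto_of_tendsto_of_tendsto_of_le_of_le' tendsto_const_nhds
    (hG.tendsto_freeResistanceOn a b) ?_ ?_
  · filter_upwards [hmem] with k hk
    have hconn := hG.connected k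
    have h0 : 0 ≤ N.traceResistanceOn (G k) a b := by
      rw [N.traceResistanceOn_eq hk.1 hk.2]
      exact effectiveResistance_nonneg (N.traceCond_nonneg _) (N.traceCond_comm _)
        (N.isConnected_traceCond _ hconn) _ _
    -- Here `G k` is fixed as the traced set while a later `G j` supplies the free resistance; the
    -- slack `r` then tends to `1`.
    refine (le_iff_forall_one_lt_le_mul₀ h0).2 fun r hr => ?_
    obtain ⟨j, hj, hj'⟩ :=
      ((hG.eventually_freeResistanceOn_le hconn hk.1 hk.2 hr).and hmem).exists
    rw [mul_comm]
    exact (N.freeResistanceInf_le (hG.connected j) hj'.1 hj'.2).trans hj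
  · filter_upwards [hmem] with k hk
    exact N.traceResistanceOn_le_freeResistanceOn (hG.connected k) hk.1 hk.2

/-! ### Existence of exhaustions. -/

variable (N)

/-- Summable rows have countable support, and connectedness reaches every vertex in finitely many
steps from one root. -/
theorem countable_of_network (N : Network V) : Countable V := by
  rcases isEmpty_or_nonempty V with _ | ⟨⟨a⟩⟩
  · infer_instance
  let S : ℕ → Set V := fun n => Nat.rec {a} (fun _ T => ⋃ x ∈ T, Function.support (N.cond x)) n
  have hS : ∀ n, (S n).Countable := by
    intro n
    induction n with
    | zero => exact Set.countable_singleton a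
    | succ n ih => exact ih.biUnion fun x _ => (N.summable x).countable_support
  refine Set.countable_univ_iff.1 ((Set.countable_iUnion hS).mono ?_)
  rintro x -
  induction N.connected a x with
  | refl => exact Set.mem_iUnion.2 ⟨0, rfl⟩
  | tail _ h ih =>
    obtain ⟨n, hn⟩ := Set.mem_iUnion.1 ih
    exact Set.mem_iUnion.2 ⟨n + 1, Set.mem_iUnion₂.2 ⟨_, hn, h.ne'⟩⟩

theorem isConnected_freeCond_of_root {H : Set V} (a : H)
    (h : ∀ x : H, Relation.ReflTransGen (fun u v => 0 < N.freeCond H u v) a x) :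
    IsConnected (N.freeCond H) := by
  intro x y
  refine Relation.ReflTransGen.trans ?_ (h y)
  have hsymm : Std.Symm fun u v => 0 < N.freeCond H u v :=
    ⟨fun u v huv => by rwa [N.freeCond_comm]⟩
  exact Relation.ReflTransGen.stdSymm.symm _ _ (h x)

theorem reflTransGen_freeCond_mono {H K : Set V} (hHK : H ⊆ K) {x y : H}
    (h : Relation.ReflTransGen (fun u v => 0 < N.freeCond H u v) x y) :
    Relation.ReflTransGen (fun u v => 0 < N.freeCond K u v)
      (Set.inclusion hHK x) (Set.inclusion hHK y) :=
  h.lift (Set.inclusion hHK) fun _ _ huv => huv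

theorem exists_finset_connected (a x : V) : ∃ K : Finset V, a ∈ K ∧ x ∈ K ∧
    IsConnected (N.freeCond (K : Set V)) := by
  classical
  induction N.connected a x with
  | refl =>
    refine ⟨{a}, by simp, by simp, fun u v => ?_⟩
    have hu := Finset.mem_singleton.1 u.2
    have hv := Finset.mem_singleton.1 v.2
    rw [Subtype.ext (hu.trans hv.symm)]
  | @tail y z _ h ih =>
    obtain ⟨K, ha, hy, hK⟩ := ih
    have hsub : (K : Set V) ⊆ (insert z K : Finset V) := Finset.coe_subset.2 (Finset.subset_insert z K)
    refine ⟨insert z K, hsub ha, Finset.mem_insert_self z K,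
      N.isConnected_freeCond_of_root ⟨a, hsub ha⟩ fun u => ?_⟩
    have hold : ∀ v (hv : v ∈ (K : Set V)), Relation.ReflTransGen
        (fun u v => 0 < N.freeCond (insert z K : Finset V) u v) ⟨a, hsub ha⟩ ⟨v, hsub hv⟩ :=
      fun v hv => N.reflTransGen_freeCond_mono hsub (hK ⟨a, ha⟩ ⟨v, hv⟩)
    obtain ⟨u, hu⟩ := u
    rcases Finset.mem_insert.1 hu with rfl | hu'
    · exact (hold y hy).tail h
    · exact hold u hu'

theorem exists_isExhaustion (a : V) : ∃ G, N.IsExhaustion G := by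
  classical
  have := countable_of_network N
  have : Nonempty V := ⟨a⟩
  obtain ⟨e, he⟩ := exists_surjective_nat V
  choose K ha hx hK using fun n => N.exists_finset_connected a (e n)
  have hsub : ∀ n k, n ≤ k → K n ⊆ (Finset.range (k + 1)).biUnion K := fun n k h =>
    Finset.subset_biUnion_of_mem K (Finset.mem_range.2 (Nat.lt_succ_of_le h))
  -- All the `K n` share the root `a`, so their unions stay connected; `k + 1` ensures that stage
  -- `0` already contains `a`.
  refine ⟨fun k => (Finset.range (k + 1)).biUnion K, ?_, ?_, ?_⟩
  · exact fun j k hjk => Finset.biUnion_subset_biUnion_of_subset_left _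
      (Finset.range_subset_range.2 (by omega))
  · intro x
    obtain ⟨n, rfl⟩ := he x
    exact ⟨n, hsub n n le_rfl (hx n)⟩
  · intro k
    refine N.isConnected_freeCond_of_root ⟨a, hsub 0 k (Nat.zero_le k) (ha 0)⟩ fun ⟨x, hxk⟩ => ?_
    obtain ⟨n, hn, hxn⟩ := Finset.mem_biUnion.1 hxk
    exact N.reflTransGen_freeCond_mono
      (Finset.coe_subset.2 (hsub n k (Nat.lt_succ_iff.1 (Finset.mem_range.1 hn))))
      (hK n ⟨a, ha n⟩ ⟨x, hxn⟩)

end Network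

end TraceRes

/-- The entries of the trace network are finite for every `H`, since the hitting probabilities are
at most `1`; this is why transience is not used in the proof. -/
theorem mainTheorem7 {V : Type*} (N : TraceRes.Network V) (hN : N.IsTransient) (a b : V) :
    ∃ R : ℝ, N.IsTraceResistance a b R ∧ N.IsFreeResistance a b R :=
  ⟨N.freeResistanceInf a b,
    ⟨N.exists_isExhaustion a, fun _ hG => hG.tendsto_traceResistanceOn a b⟩,
    ⟨N.exists_isExhaustion a, fun _ hG => hG.tendsto_freeResistanceOn a b⟩⟩
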